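/- **Theorem.** Let $d\ge 1$, $f\ge 0$, $n\ge 2$, and let $G=(\mathcal V,\mathcal E)$ be a directed graph without self-loops on a set $\mathcal V$ of $n$ processes; $N_i^-=\{j:(j,i)\in\mathcal E\}$. For sets $A,B\subseteq\mathcal V$ write $A\Rightarrow_{c}B$ if some $v\in B$ has $|N_v^-\cap A|\ge c+1$. Assume Condition SC: for every partition $F,L,C,R$ of $\mathcal V$ with $L,R$ non-empty and $|F|\le f$, either $R\cup C\Rightarrow_{df}L$ or $L\cup C\Rightarrow_{df}R$. *Algorithm Byz-Iter.* The system is synchronous. A set $\mathcal F$ of at most $f$ processes is faulty. Every fault-free process $i$ holds a state $\mathbf v_i\in\mathbb R^d$; $\mathbf v_i[0]$ is its input, whose coordinates all lie in $[\mu,U]$, where the reals $\mu,U$ are known in advance. In iteration $t\ge1$ each fault-free process sends $\mathbf v_i[t-1]$ along all its outgoing edges; each faulty process sends to each of its out-neighbours an arbitrary value (possibly different values to different neighbours) or nothing, and a missing message is read as $0\in\mathbb R^d$. Let $r_i[t]$ be the multiset, of size $|N_i^-|$, of the values received by $i$. For each sub-multiset $Y\subseteq r_i[t]$ of size $(d+1)f+1$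 (counted with multiplicity, so that there are $\binom{|N_i^-|}{(d+1)f+1}$ of them), process $i$ puts into a multiset $Z_i[t]$ one arbitrarily chosen Tverberg point of $Y$, that is, a point of $\bigcap_{l=1}^{f+1}\mathrm{conv}(Y_l)$ for some partition of $Y$ into non-empty multisets $Y_1,\dots,Y_{f+1}$. Then $$\mathbf v_i[t]=\frac{\mathbf v_i[t-1]+\sum_{\mathbf z\in Z_i[t]}\mathbf z}{1+|Z_i[t]|}.$$ Each fault-free process terminates after $t_{end}$ iterations and decides on its state at that time. *The number $t_{end}$.* For $F\subseteq\mathcal V$ with $|F|\le f$, a reduced graph is a graph on $\mathcal V\setminus F$ obtained from the subgraph of $G$ induced on $\mathcal V\setminus F$ by removing at most $df$ incoming edges at each vertex. Let $r$ be the maximum over all such $F$ of the number of reduced graphs. Let $\beta=\frac1n$ if $f=0$ and $\beta=\frac{1}{n^2\left(1+\binom{n}{(d+1)f+1}\right)}$ if $f>0$. For $\varepsilon>0$, $t_{end}$ is the smallest positive integer $t$ such that $$\left(1-\beta^{rn}\right)^{\lfloor t/(rn)\rfloor}\; n\max(|U|,|\mu|)<\varepsilon .$$ *Conclusion.* The integer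 $t_{end}$ exists, and in every iteration each fault-free process can perform its update step whatever values it receives. Moreover, for every faulty set $\mathcal F$ with $|\mathcal F|\le f$, all inputs as above, every behaviour of the faulty processes and all choices of Tverberg points: * (Termination) every fault-free process terminates after finitely many iterations; * (Validity) the state of each fault-free process is, after every iteration, in the convex hull of the inputs of the fault-free processes; * ($\varepsilon$-Agreement) for any two fault-free processes and every $1\le l\le d$, the $l$-th coordinates of their decisions differ by less than $\varepsilon$. -/

import Mathlib

/-! ## Directed graphs: Condition SC and reduced graphs -/

/-- The set `N_i^-` of processes that have an edge to `i`. -/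
noncomputable def inNbrs {n : ℕ} (G : Digraph (Fin n)) (i : Fin n) : Finset (Fin n) := by
  classical exact Finset.univ.filter fun j => G.Adj j i

/-- `A ⇒_c B`: some process in `B` has at least `c + 1` incoming edges from processes in `A`. -/
def FeedsInto {n : ℕ} (G : Digraph (Fin n)) (c : ℕ) (A B : Finset (Fin n)) : Prop :=
  ∃ v ∈ B, c + 1 ≤ (inNbrs G v ∩ A).card

/-- Condition SC for dimension `d` and at most `f` faults. -/
def ConditionSC {n : ℕ} (d f : ℕ) (G : Digraph (Fin n)) : Prop :=
  ∀ F L C R : Finset (Fin n),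
    Disjoint F L → Disjoint F C → Disjoint F R → Disjoint L C → Disjoint L R → Disjoint C R →
    F ∪ L ∪ C ∪ R = Finset.univ → L.Nonempty → R.Nonempty → F.card ≤ f →
    FeedsInto G (d * f) (R ∪ C) L ∨ FeedsInto G (d * f) (L ∪ C) R

/-- `H` is a reduced graph of `G` for the fault set `F`: its vertices are the processes outside `F`,
and its edges are those of `G` between such processes, except that up to `d * f` incoming edges
have been removed at each process. -/
def IsReducedGraph {n : ℕ} (d f : ℕ) (G : Digraph (Fin n)) (F : Finset (Fin n))
    (H : Digraph {v : Fin n // v ∉ F}) : Prop :=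
  (∀ a b : {v : Fin n // v ∉ F}, H.Adj a b → G.Adj a b) ∧
    ∀ b : {v : Fin n // v ∉ F}, {a : {v : Fin n // v ∉ F} | G.Adj a b ∧ ¬ H.Adj a b}.ncard ≤ d * f

/-! ## The number of iterations -/

/-- `r`: the maximum, over all `F` with `|F| ≤ f`, of the number of reduced graphs for `F`. -/
noncomputable def maxReduced {n : ℕ} (d f : ℕ) (G : Digraph (Fin n)) : ℕ :=
  (Finset.univ.filter fun F : Finset (Fin n) => F.card ≤ f).sup fun F =>
    {H : Digraph {v : Fin n // v ∉ F} | IsReducedGraph d f G F H}.ncard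

/-- The constant `β`. -/
noncomputable def beta (n d f : ℕ) : ℝ :=
  if f = 0 then 1 / (n : ℝ)
  else 1 / ((n : ℝ) ^ 2 * (1 + (n.choose ((d + 1) * f + 1) : ℝ)))

/-- The contraction bound `(1 - β ^ (r n)) ^ ⌊t / (r n)⌋`. -/
noncomputable def contraction {n : ℕ} (d f : ℕ) (G : Digraph (Fin n)) (t : ℕ) : ℝ :=
  (1 - beta n d f ^ (maxReduced d f G * n)) ^ (t / (maxReduced d f G * n))

/-- The positive integers `t` with `(1 - β ^ (r n)) ^ ⌊t / (r n)⌋ < ε / (n * max(|U|, |μ|))`;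
the denominator is cleared, so that every `t ≥ 1` qualifies when `U = μ = 0`. -/
def stoppingTimes {n : ℕ} (d f : ℕ) (G : Digraph (Fin n)) (μ U ε : ℝ) : Set ℕ :=
  {t | 0 < t ∧ contraction d f G t * ((n : ℝ) * max |U| |μ|) < ε}

/-- `t_end`: the smallest stopping time. -/
noncomputable def tEnd {n : ℕ} (d f : ℕ) (G : Digraph (Fin n)) (μ U ε : ℝ) : ℕ :=
  sInf (stoppingTimes d f G μ U ε)

/-! ## The algorithm Byz-Iter -/

/-- Points of `d`-dimensional real space. -/
abbrev Point (d : ℕ) : Type := Fin d → ℝ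

/-- `p` is a Tverberg point of the multiset `Y`: it lies in the convex hull of every part of some
partition of `Y` into `f + 1` non-empty multisets. -/
def IsTverbergPoint {d : ℕ} (f : ℕ) (Y : Multiset (Point d)) (p : Point d) : Prop :=
  ∃ P : Fin (f + 1) → Multiset (Point d),
    ∑ l, P l = Y ∧ (∀ l, P l ≠ 0) ∧ ∀ l, p ∈ convexHull ℝ {q | q ∈ P l}

/-- The update step: `y` is a possible new state of a process with state `x` that received the
multiset `r`. The multiset `Z` holds one (arbitrarily chosen) Tverberg point for each sub-multiset
of `r` of size `(d + 1) f + 1`, these being counted with multiplicity, and `y` is the average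
of `x` and the members of `Z`. -/
def IsUpdate {d : ℕ} (f : ℕ) (r : Multiset (Point d)) (x y : Point d) : Prop :=
  ∃ Z : Multiset (Point d),
    Multiset.Rel (IsTverbergPoint f) (r.powersetCard ((d + 1) * f + 1)) Z ∧
      y = (1 + (Z.card : ℝ))⁻¹ • (x + Z.sum)

/-- What a process carries along: the number of iterations it has completed, and its state. -/
structure ProcState (d : ℕ) where
  iter : ℕ
  value : Point d

/-- A process has terminated once it has completed `T` iterations. -/
def Halted {d : ℕ} (T : ℕ) (p : ProcState d) : Prop := T ≤ p.iter

open Classical in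
/-- The message (if any) that `j` sends to `i` in a round that starts from the global state `s`.
A fault-free process sends its state until it terminates; a faulty process sends whatever `adv`
prescribes, possibly different values to different processes, or nothing. -/
noncomputable def message {n d : ℕ} (T : ℕ) (F : Finset (Fin n)) (s : Fin n → ProcState d)
    (adv : Fin n → Fin n → Option (Point d)) (j i : Fin n) : Option (Point d) :=
  if j ∈ F then adv j i else if Halted T (s j) then none else some (s j).value

/-- The multiset of values that `i` receives; a missing message counts as the zero vector. -/
noncomputable def received {n d : ℕ} (G : Digraph (Fin n)) (T : ℕ) (F : Finset (Fin n))
    (s : Fin n → ProcState d) (adv : Fin n → Fin n → Option (Point d)) (i : Fin n) :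
    Multiset (Point d) :=
  (inNbrs G i).val.map fun j => (message T F s adv j i).getD 0

/-- One synchronous round of Byz-Iter with fault set `F` and termination after `T` iterations:
each fault-free process that has not terminated performs an iteration, and each that has terminated
stays as it is. Nothing is required of the faulty processes. -/
def IsRound {n d : ℕ} (f : ℕ) (G : Digraph (Fin n)) (T : ℕ) (F : Finset (Fin n))
    (s : Fin n → ProcState d) (adv : Fin n → Fin n → Option (Point d))
    (s' : Fin n → ProcState d) : Prop :=
  ∀ i, i ∉ F →
    (Halted T (s i) → s' i = s i) ∧
    (¬ Halted T (s i) →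
      (s' i).iter = (s i).iter + 1 ∧
        IsUpdate f (received G T F s adv i) (s i).value (s' i).value)

/-- `c` (the global state after each number of rounds) is an execution of Byz-Iter with the given
inputs, in which the faulty processes send the messages `adv`. -/
def IsExecution {n d : ℕ} (f : ℕ) (G : Digraph (Fin n)) (T : ℕ) (F : Finset (Fin n))
    (input : Fin n → Point d) (adv : ℕ → Fin n → Fin n → Option (Point d))
    (c : ℕ → Fin n → ProcState d) : Prop :=
  (∀ i, i ∉ F → c 0 i = ⟨0, input i⟩) ∧ ∀ k, IsRound f G T F (c k) (adv k) (c (k + 1))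

/-! ## The three conditions of Byzantine vector consensus -/

/-- In the execution `c`, process `i` terminates with the decision `y`. -/
def Decides {n d : ℕ} (T : ℕ) (c : ℕ → Fin n → ProcState d) (i : Fin n) (y : Point d) : Prop :=
  ∃ k, Halted T (c k i) ∧ (c k i).value = y

/-- Each fault-free process terminates after finitely many rounds. -/
def Termination {n d : ℕ} (T : ℕ) (F : Finset (Fin n)) (c : ℕ → Fin n → ProcState d) : Prop :=
  ∀ i, i ∉ F → ∃ y, Decides T c i y

/-- At all times the state of each fault-free process is in the convex hull of the inputs of the
fault-free processes. -/
def Validity {n d : ℕ} (F : Finset (Fin n)) (input : Fin n → Point d)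
    (c : ℕ → Fin n → ProcState d) : Prop :=
  ∀ k i, i ∉ F → (c k i).value ∈ convexHull ℝ (input '' {j | j ∉ F})

/-- Corresponding coordinates of the decisions of any two fault-free processes differ by less
than `ε`. -/
def EpsAgreement {n d : ℕ} (T : ℕ) (ε : ℝ) (F : Finset (Fin n))
    (c : ℕ → Fin n → ProcState d) : Prop :=
  ∀ i j, i ∉ F → j ∉ F → ∀ y y', Decides T c i y → Decides T c j y' → ∀ l, |y l - y' l| < ε

/-! The faulty values can be eliminated from the update. A Tverberg point of `(d+1)f+1` received
values lies in the hulls of `f+1` parts. At most `f` of the values are faulty, so some part is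
entirely fault-free. Averaging over the fault-free parts writes the point as a convex combination of
fault-free states. Any `df+1` fault-free values in the selection leave only `f` others, hence
contain a whole part and so a member of substantial weight (`IsTverbergPoint.exists_weights`). Thus
a process gives weight at least `β` to itself and to all but `df` of its fault-free in-neighbours,
so each iteration is an averaging along a reduced graph (`IsRound.exists_weights`). Validity follows
at once.

For agreement, Condition SC rules out two disjoint non-empty sets without incoming edges in a
reduced graph, so every reduced graph has a root (`ConditionSC.exists_root`). Among `rn` consecutive
iterations some reduced graph occurs at least as often as there are fault-free processes. Its root
influences one more process at each occurrence and loses none, because of the self-weights. Every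
process then carries weight at least `β^(rn)` from that root, and the spread of each coordinate
shrinks by `1 - β^(rn)` (`spread_contracts`).

Existence of Tverberg points is obtained by Sarkaria's tensor argument from the colourful
Carathéodory theorem, itself proved by Bárány's nearest-transversal argument. -/

/-! ## Convex combinations of indexed families -/

/-- A point of the convex hull of the values of `g` on `s` is a convex combination of `g`
with weights supported on `s`. -/
theorem exists_weights_of_mem_convexHull_image {ι E : Type*} [Fintype ι] [AddCommGroup E]
    [Module ℝ E] {g : ι → E} {s : Set ι} {p : E} (hp : p ∈ convexHull ℝ (g '' s)) :
    ∃ w : ι → ℝ, (∀ i, 0 ≤ w i) ∧ (∀ i, i ∉ s → w i = 0) ∧ ∑ i, w i = 1 ∧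
      ∑ i, w i • g i = p := by
  classical
  obtain ⟨κ, _, w, z, hw0, hw1, hz, hp⟩ := mem_convexHull_iff_exists_fintype.1 hp
  choose idx hidx hg using hz
  refine ⟨fun i => ∑ k with idx k = i, w k, fun i => Finset.sum_nonneg fun k _ => hw0 k,
    fun i hi => ?_, ?_, ?_⟩
  · refine Finset.sum_eq_zero fun k hk => ?_
    exact absurd ((Finset.mem_filter.1 hk).2 ▸ hidx k) hi
  · exact (Finset.sum_fiberwise Finset.univ idx w).trans hw1
  · rw [← hp, ← Finset.sum_fiberwise Finset.univ idx fun k => w k • z k]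
    refine Finset.sum_congr rfl fun i _ => ?_
    rw [Finset.sum_smul]
    refine Finset.sum_congr rfl fun k hk => ?_
    rw [← hg k, (Finset.mem_filter.1 hk).2]

/-! ## The colourful Carathéodory theorem -/

/-- The squared norm has negative derivative at `p` in the direction of `x`, so a short enough move
decreases it. -/
theorem exists_mem_segment_norm_lt {E : Type*} [NormedAddCommGroup E] [InnerProductSpace ℝ E]
    {p x : E} (h : inner ℝ p x < ‖p‖ ^ 2) : ∃ y ∈ segment ℝ p x, ‖y‖ < ‖p‖ := by
  have ha : inner ℝ p (x - p) = inner ℝ p x - ‖p‖ ^ 2 := by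
    rw [inner_sub_right, real_inner_self_eq_norm_sq]
  set a := ‖p‖ ^ 2 - inner ℝ p x with hadef
  have hapos : 0 < a := sub_pos.2 h
  set b := ‖x - p‖ ^ 2 with hb
  have hb0 : 0 ≤ b := sq_nonneg _
  -- This choice gives `0 < t ≤ 1` and `t * b ≤ a`, so the change `-2ta + t²b` of the squared norm
  -- is at most `-ta`.
  set t := a / (b + a) with ht
  have hba : 0 < b + a := by linarith
  have ht0 : 0 < t := div_pos hapos hba
  have ht1 : t ≤ 1 := (div_le_one hba).2 (by linarith)
  have htb : t * (b + a) = a := div_mul_cancel₀ _ hba.ne'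
  refine ⟨p + t • (x - p), ?_, ?_⟩
  · rw [segment_eq_image']
    exact ⟨t, ⟨ht0.le, ht1⟩, rfl⟩
  · refine lt_of_pow_lt_pow_left₀ 2 (norm_nonneg _) ?_
    rw [norm_add_sq_real, inner_smul_right, ha, norm_smul, mul_pow, Real.norm_eq_abs, sq_abs,
      ← hb]
    have h1 : t * b ≤ a := by nlinarith
    have h2 : t * (t * b) ≤ t * a := mul_le_mul_of_nonneg_left h1 ht0.le
    nlinarith [mul_pos ht0 hapos]

/-- **Colourful Carathéodory theorem**: if zero is in the convex hull of each of more than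
`finrank ℝ E` families, then it is in the convex hull of a transversal of these families. -/
theorem colorful_caratheodory {ι κ E : Type*} [Fintype ι] [Nonempty ι] [Finite κ]
    [NormedAddCommGroup E] [InnerProductSpace ℝ E] [FiniteDimensional ℝ E]
    (hcard : Module.finrank ℝ E < Fintype.card ι) (v : ι → κ → E)
    (hv : ∀ i, (0 : E) ∈ convexHull ℝ (Set.range (v i))) :
    ∃ c : ι → κ, (0 : E) ∈ convexHull ℝ (Set.range fun i => v i (c i)) := by
  classical
  have : Nonempty κ := by
    obtain ⟨i⟩ := ‹Nonempty ι›
    exact Set.range_nonempty_iff_nonempty.1 (convexHull_nonempty_iff.1 ⟨_, hv i⟩)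
  let K : (ι → κ) → Set E := fun c => convexHull ℝ (Set.range fun i => v i (c i))
  obtain ⟨c, hc⟩ := Finite.exists_min fun c => Metric.infDist 0 (K c)
  have hcompact : IsCompact (K c) := (Set.finite_range _).isCompact_convexHull ℝ
  obtain ⟨p, hpK, hp⟩ := hcompact.exists_infDist_eq_dist
    (convexHull_nonempty_iff.2 (Set.range_nonempty _)) (0 : E)
  rw [dist_zero_left] at hp
  have hmin : ∀ c' y, y ∈ K c' → ‖p‖ ≤ ‖y‖ := fun c' y hy => by
    rw [← hp, ← dist_zero_left]
    exact (hc c').trans (Metric.infDist_le_dist_of_mem hy)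
  refine ⟨c, ?_⟩
  by_cases hp0 : p = 0
  · exact hp0 ▸ hpK
  exfalso
  have hpp : 0 < ‖p‖ ^ 2 := by positivity
  have hhalf : ∀ x ∈ K c, ‖p‖ ^ 2 ≤ inner ℝ p x := by
    intro x hx
    by_contra! hlt
    obtain ⟨y, hy, hlt⟩ := exists_mem_segment_norm_lt hlt
    exact (hmin c y ((convex_convexHull ℝ _).segment_subset hpK hx hy)).not_gt hlt
  -- The points used by `p` all lie on the supporting hyperplane `⟨p, ·⟩ = ‖p‖²`. It misses zero, so
  -- their affine independence becomes linear independence.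
  obtain ⟨τ, _, z, w, hz, hind, hw0, hw1, hwz⟩ := eq_pos_convex_span_of_mem_convexHull hpK
  have hzp : ∀ k, inner ℝ p (z k) = ‖p‖ ^ 2 := by
    have hsum : ∑ k, w k * (inner ℝ p (z k) - ‖p‖ ^ 2) = 0 := by
      have : ∑ k, w k * inner ℝ p (z k) = ‖p‖ ^ 2 := by
        rw [← real_inner_self_eq_norm_sq]
        nth_rw 3 [← hwz]
        rw [inner_sum]
        simp [inner_smul_right]
      simp only [mul_sub, Finset.sum_sub_distrib, this, ← Finset.sum_mul, hw1, one_mul, sub_self]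
    intro k
    have hk := (Finset.sum_eq_zero_iff_of_nonneg fun k _ => mul_nonneg (hw0 k).le
      (sub_nonneg.2 (hhalf _ (subset_convexHull ℝ _ (hz ⟨k, rfl⟩))))).1 hsum k (Finset.mem_univ k)
    exact sub_eq_zero.1 ((mul_eq_zero.1 hk).resolve_left (hw0 k).ne')
  have hlin : LinearIndependent ℝ z := by
    rw [Fintype.linearIndependent_iff]
    intro g hg
    have hg0 : ∑ k, g k = 0 := by
      have h1 : inner ℝ p (∑ k, g k • z k) = 0 := by rw [hg, inner_zero_right]
      rw [inner_sum] at h1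
      simp only [inner_smul_right, hzp, ← Finset.sum_mul] at h1
      exact (mul_eq_zero.1 h1).resolve_right hpp.ne'
    intro k
    exact affineIndependent_iff.1 hind Finset.univ g hg0 hg k (Finset.mem_univ k)
  choose idx hidx using fun k => hz ⟨k, rfl⟩
  -- Some family is not needed to represent `p`; exchanging its representative keeps `p` in the
  -- hull.
  obtain ⟨i, hi⟩ : ∃ i, ∀ k, idx k ≠ i := by
    by_contra! hsurj
    exact absurd ((Fintype.card_le_of_surjective idx hsurj).trans hlin.fintype_card_le_finrank)
      hcard.not_ge
  obtain ⟨j, hj⟩ : ∃ j, inner ℝ p (v i j) ≤ 0 := by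
    by_contra! hpos
    have hsub : convexHull ℝ (Set.range (v i)) ⊆ {x | 0 < inner ℝ p x} := by
      refine convexHull_min (Set.range_subset_iff.2 hpos) ?_
      exact (convex_Ioi (0 : ℝ)).linear_preimage (innerₗ E p)
    have := hsub (hv i)
    simp at this
  obtain ⟨y, hy, hlt⟩ := exists_mem_segment_norm_lt (hj.trans_lt hpp)
  refine (hmin (Function.update c i j) y ?_).not_gt hlt
  refine (convex_convexHull ℝ _).segment_subset ?_ ?_ hy
  · refine mem_convexHull_of_exists_fintype w z (fun k => (hw0 k).le) hw1 (fun k => ?_) hwz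
    exact ⟨idx k, by simp only [Function.update_of_ne (hi k)]; exact hidx k⟩
  · exact subset_convexHull ℝ _ ⟨i, by simp⟩

/-! ## Tverberg's theorem -/

/-- `f + 1` vectors in `ℝ^f` whose only linear relations are the constant ones. -/
def simplexVertex (f : ℕ) (l : Fin (f + 1)) (m : Fin f) : ℝ :=
  if l = m.castSucc then 1 else if l = Fin.last f then -1 else 0

/-- Each coordinate compares one coefficient with the last, so a vanishing combination has all
coefficients equal. -/
theorem sum_mul_simplexVertex {f : ℕ} (x : Fin (f + 1) → ℝ) (m : Fin f) :
    ∑ l, x l * simplexVertex f l m = x m.castSucc - x (Fin.last f) := by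
  rw [Fin.sum_univ_castSucc]
  simp [simplexVertex, (Fin.castSucc_lt_last m).ne', (Fin.castSucc_lt_last _).ne, sub_eq_add_neg]

/-- **Tverberg's theorem**: `(d + 1) f + 1` points of `ℝ^d` can be coloured with `f + 1` colours
so that the convex hulls of the colour classes have a common point. -/
theorem tverberg {ι : Type*} [Fintype ι] (d f : ℕ) (hcard : Fintype.card ι = (d + 1) * f + 1)
    (a : ι → Fin d → ℝ) :
    ∃ (c : ι → Fin (f + 1)) (p : Fin d → ℝ), ∀ l, p ∈ convexHull ℝ (a '' {i | c i = l}) := by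
  classical
  have : Nonempty ι := Fintype.card_pos_iff.1 (by omega)
  let b : ι → Option (Fin d) → ℝ := fun i k => k.elim 1 (a i)
  -- The tensors `(1, a i) ⊗ u_l`, with `u_l` the simplex vectors, live in dimension `(d+1)f`, one
  -- less than the number of points. A vanishing convex combination of a transversal makes the
  -- colour-class sums `X l` equal.
  let v : ι → Fin (f + 1) → EuclideanSpace ℝ (Option (Fin d) × Fin f) := fun i l =>
    WithLp.toLp 2 fun km => b i km.1 * simplexVertex f l km.2
  have hf : (0 : ℝ) < f + 1 := by positivity
  have hv : ∀ i, 0 ∈ convexHull ℝ (Set.range (v i)) := by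
    intro i
    refine mem_convexHull_of_exists_fintype (fun _ : Fin (f + 1) => ((f : ℝ) + 1)⁻¹) (v i)
      (fun _ => by positivity) (by simp [hf.ne']) (fun l => ⟨l, rfl⟩) ?_
    ext ⟨k, m⟩
    have := sum_mul_simplexVertex (fun _ : Fin (f + 1) => ((f : ℝ) + 1)⁻¹ * b i k) m
    simpa [v, mul_assoc] using this
  obtain ⟨c, hc⟩ := colorful_caratheodory (by simp [hcard]) v hv
  rw [← Set.image_univ] at hc
  obtain ⟨w, hw0, -, hw1, hw⟩ := exists_weights_of_mem_convexHull_image hc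
  let X : Fin (f + 1) → Option (Fin d) → ℝ := fun l k => ∑ i with c i = l, w i * b i k
  have hX : ∀ l k, X l k = X (Fin.last f) k := by
    intro l k
    induction l using Fin.lastCases with
    | last => rfl
    | cast m =>
      refine sub_eq_zero.1 ?_
      rw [← sum_mul_simplexVertex (fun l => X l k) m]
      have h0 := congrArg (fun y : EuclideanSpace ℝ (Option (Fin d) × Fin f) => y (k, m)) hw
      simp only [WithLp.ofLp_sum, WithLp.ofLp_smul, Finset.sum_apply, Pi.smul_apply, smul_eq_mul,
        WithLp.ofLp_zero, Pi.zero_apply, v] at h0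
      rw [← h0, ← Finset.sum_fiberwise Finset.univ c]
      refine Finset.sum_congr rfl fun l _ => ?_
      rw [Finset.sum_mul]
      refine Finset.sum_congr rfl fun i hi => ?_
      rw [(Finset.mem_filter.1 hi).2, mul_assoc]
  -- The added coordinate `1` shows that all classes have equal total weight, so rescaling by `f +
  -- 1` gives convex weights.
  have hXnone : ∀ l, ((f : ℝ) + 1) * ∑ i with c i = l, w i = 1 := by
    intro l
    have h1 : ∑ l, X l none = 1 := by
      rw [← hw1, ← Finset.sum_fiberwise Finset.univ c w]
      simp [X, b]
    simp only [hX _ none, Finset.sum_const, Finset.card_univ, Fintype.card_fin, nsmul_eq_mul,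
      Nat.cast_add, Nat.cast_one] at h1
    rw [← hX l none] at h1
    simpa [X, b] using h1
  refine ⟨c, fun k => (f + 1) * X (Fin.last f) (some k), fun l => ?_⟩
  refine mem_convexHull_of_exists_fintype (fun i : {i // c i = l} => ((f : ℝ) + 1) * w i)
    (fun i => a i) (fun i => mul_nonneg hf.le (hw0 i)) ?_ (fun i => ⟨i, i.2, rfl⟩) ?_
  · refine Eq.trans ?_ (hXnone l)
    rw [Finset.mul_sum]
    exact (Finset.sum_subtype (F := inferInstance) (Finset.univ.filter fun i => c i = l)
      (fun i => by simp) (fun i => ((f : ℝ) + 1) * w i)).symm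
  · ext k
    rw [← hX l, Finset.mul_sum, Finset.sum_apply]
    simp only [Pi.smul_apply, smul_eq_mul, mul_assoc]
    exact (Finset.sum_subtype (F := inferInstance) (Finset.univ.filter fun i => c i = l)
      (fun i => by simp) (fun i => ((f : ℝ) + 1) * (w i * a i k))).symm

/-! ## Multisets of values and the update step -/

/-- Passes from multisets of values to functions on indices, so that equal values from different
indices stay distinguishable. -/
theorem exists_map_of_rel {α β : Type*} [Nonempty β] {r : α → β → Prop} {s : Finset α}
    {Z : Multiset β} (h : Multiset.Rel r s.val Z) :
    ∃ z : α → β, Z = s.val.map z ∧ ∀ a ∈ s, r a (z a) := by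
  classical
  induction s using Finset.induction_on generalizing Z with
  | empty =>
    obtain rfl := Multiset.rel_zero_left.1 h
    exact ⟨fun _ => Classical.arbitrary β, by simp, by simp⟩
  | insert a s ha ih =>
    rw [Finset.insert_val_of_notMem ha, Multiset.rel_cons_left] at h
    obtain ⟨b, Z', hab, hZ', rfl⟩ := h
    obtain ⟨z, rfl, hz⟩ := ih hZ'
    have hne : ∀ x ∈ s, x ≠ a := fun x hx hxa => ha (hxa ▸ hx)
    refine ⟨Function.update z a b, ?_, fun x hx => ?_⟩
    · rw [Finset.insert_val_of_notMem ha, Multiset.map_cons, Function.update_self]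
      congr 1
      exact Multiset.map_congr rfl fun x hx => (Function.update_of_ne (hne x hx) _ _).symm
    · rcases Finset.mem_insert.1 hx with rfl | hx
      · simpa using hab
      · simpa [Function.update_of_ne (hne x hx)] using hz x hx

/-- Every multiset of `(d + 1) f + 1` points of `ℝ^d` has a Tverberg point. -/
theorem exists_isTverbergPoint {d : ℕ} (f : ℕ) (Y : Multiset (Point d))
    (hY : Y.card = (d + 1) * f + 1) : ∃ p, IsTverbergPoint f Y p := by
  classical
  let a : Y.ToType → Point d := fun x => x.1
  obtain ⟨c, p, hp⟩ := tverberg d f (by rw [Multiset.card_coe, hY]) a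
  have hmap : ∀ s : Finset Y.ToType, ∑ i ∈ s, ({a i} : Multiset (Point d)) = s.val.map a := by
    intro s
    rw [Finset.sum, ← Multiset.sum_map_singleton (s.val.map a), Multiset.map_map]
    rfl
  have hsub : ∀ l, {q | q ∈ ∑ i with c i = l, ({a i} : Multiset (Point d))} = a '' {i | c i = l} := by
    intro l
    ext q
    simp [Multiset.mem_sum, eq_comm]
  refine ⟨p, fun l => ∑ i with c i = l, {a i}, ?_, fun l h0 => ?_, fun l => ?_⟩
  · rw [Finset.sum_fiberwise, hmap]
    exact Multiset.map_univ_coe Y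
  · have := hp l
    rw [← hsub] at this
    beta_reduce at h0
    rw [h0] at this
    simp at this
  · rw [hsub]
    exact hp l

/-- The update step can be performed whatever is received. -/
theorem exists_isUpdate {d : ℕ} (f : ℕ) (r : Multiset (Point d)) (x : Point d) :
    ∃ y, IsUpdate f r x y := by
  classical
  choose! p hp using exists_isTverbergPoint (d := d) f
  refine ⟨_, (r.powersetCard ((d + 1) * f + 1)).map p, ?_, rfl⟩
  rw [Multiset.rel_map_right]
  exact Multiset.rel_refl_of_refl_on fun Y hY => hp Y (Multiset.mem_powersetCard.1 hY).2

/-- A Tverberg point of an indexed family comes from a colouring of the index set. -/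
theorem IsTverbergPoint.exists_coloring {d f : ℕ} {α : Type*} {s : Finset α} {g : α → Point d}
    {p : Point d} (hp : IsTverbergPoint f (s.val.map g) p) :
    ∃ c : α → Fin (f + 1), (∀ l, ∃ a ∈ s, c a = l) ∧
      ∀ l, p ∈ convexHull ℝ (g '' {a | a ∈ s ∧ c a = l}) := by
  classical
  obtain ⟨P, hP, hP0, hp⟩ := hp
  -- Each value is tagged with its part; matching `T` with the indices then colours them
  -- consistently even when values repeat.
  let T : Multiset (Fin (f + 1) × Point d) := ∑ l, (P l).map fun q => (l, q)
  have hT : T.map Prod.snd = s.val.map g := by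
    rw [← hP, ← Multiset.coe_mapAddMonoidHom, map_sum]
    simp
  have hrel : Multiset.Rel (fun a x => g a = x.2) s.val T := by
    rw [← Multiset.rel_eq, Multiset.rel_map] at hT
    exact (Multiset.rel_flip.2 hT).mono fun a _ x _ h => h.symm
  obtain ⟨h, hTh, hg⟩ := exists_map_of_rel hrel
  have hmem : ∀ l q, q ∈ P l → ∃ a ∈ s, h a = (l, q) := by
    intro l q hq
    have : (l, q) ∈ T := Multiset.mem_sum.2 ⟨l, Finset.mem_univ l, Multiset.mem_map_of_mem _ hq⟩
    rw [hTh] at this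
    simpa using this
  refine ⟨fun a => (h a).1, fun l => ?_, fun l => ?_⟩
  · obtain ⟨q, hq⟩ := Multiset.exists_mem_of_ne_zero (hP0 l)
    obtain ⟨a, ha, hal⟩ := hmem l q hq
    exact ⟨a, ha, congrArg Prod.fst hal⟩
  · refine convexHull_mono ?_ (hp l)
    intro q hq
    obtain ⟨a, ha, hal⟩ := hmem l q hq
    exact ⟨a, ⟨ha, congrArg Prod.fst hal⟩, by rw [hg a ha, hal]⟩

/-- A Tverberg point of `(d + 1) f + 1` values, of which at most `f` are indexed by `F`, is a convex
combination of the other ones in which every `d f + 1` of these include one with a weight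
that is not small. -/
theorem IsTverbergPoint.exists_weights {d f : ℕ} {α : Type*} [Fintype α] [DecidableEq α]
    {s F : Finset α} {g : α → Point d} {p : Point d} (hp : IsTverbergPoint f (s.val.map g) p)
    (hs : s.card = (d + 1) * f + 1) (hF : F.card ≤ f) :
    ∃ w : α → ℝ, (∀ a, 0 ≤ w a) ∧ (∀ a, a ∉ s \ F → w a = 0) ∧ ∑ a, w a = 1 ∧
      ∑ a, w a • g a = p ∧
      ∀ S ⊆ s, Disjoint S F → S.card = d * f + 1 →
        ∃ a ∈ S, 1 / (((f : ℝ) + 1) * ((d + 1) * f + 1)) ≤ w a := by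
  obtain ⟨c, hc, hp⟩ := hp.exists_coloring
  choose u hu0 hus hu1 hup using fun l => exists_weights_of_mem_convexHull_image (hp l)
  have hpig : ∀ A : Finset α, A.card ≤ f → ∃ l, ∀ a ∈ A, c a ≠ l := by
    intro A hA
    by_contra! h
    have : Finset.univ ⊆ A.image c := fun l _ => by
      obtain ⟨a, ha, hl⟩ := h l
      exact Finset.mem_image.2 ⟨a, ha, hl⟩
    have := (Finset.card_le_card this).trans Finset.card_image_le
    simp at this
    omega
  -- The fault-free colours. All of them are averaged because the class contained in `S` depends on
  -- `S`, while the weights must serve every `S`.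
  let Q : Finset (Fin (f + 1)) := Finset.univ.filter fun l => ∀ a ∈ s ∩ F, c a ≠ l
  have hQ : ∀ l, l ∈ Q ↔ ∀ a ∈ s ∩ F, c a ≠ l := fun l => by simp [Q]
  have hQpos : 0 < Q.card := by
    obtain ⟨l, hl⟩ := hpig (s ∩ F) ((Finset.card_le_card Finset.inter_subset_right).trans hF)
    exact Finset.card_pos.2 ⟨l, (hQ l).2 hl⟩
  have hQle : Q.card ≤ f + 1 := by simpa using Finset.card_le_univ Q
  have hQ0 : (0 : ℝ) < Q.card := by exact_mod_cast hQpos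
  refine ⟨fun a => (Q.card : ℝ)⁻¹ * ∑ l ∈ Q, u l a, fun a => ?_, fun a ha => ?_, ?_, ?_, ?_⟩
  · exact mul_nonneg (by positivity) (Finset.sum_nonneg fun l _ => hu0 l a)
  · beta_reduce
    rw [Finset.sum_eq_zero, mul_zero]
    intro l hl
    refine hus l a fun ⟨has, hal⟩ => ?_
    have haF : a ∈ F := by simpa [has] using ha
    exact (hQ l).1 hl a (Finset.mem_inter.2 ⟨has, haF⟩) hal
  · rw [← Finset.mul_sum, Finset.sum_comm]
    simp [hu1, hQ0.ne']
  · simp only [mul_smul, Finset.sum_smul]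
    rw [← Finset.smul_sum, Finset.sum_comm]
    simp only [hup, Finset.sum_const, ← Nat.cast_smul_eq_nsmul ℝ, smul_smul]
    rw [inv_mul_cancel₀ hQ0.ne', one_smul]
  · intro S hSs hSF hScard
    -- Only `f` indices lie outside `S`, so one colour class is contained in `S`.
    obtain ⟨l, hl⟩ := hpig (s \ S) (by
      rw [Finset.card_sdiff_of_subset hSs, hs, hScard, add_mul]; omega)
    have hlQ : l ∈ Q := (hQ l).2 fun a ha => hl a <| by
      rw [Finset.mem_inter] at ha
      exact Finset.mem_sdiff.2 ⟨ha.1, fun haS => Finset.disjoint_left.1 hSF haS ha.2⟩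
    obtain ⟨a, haS, ha⟩ : ∃ a ∈ S, 1 / (((d : ℝ) + 1) * f + 1) ≤ u l a := by
      by_contra! hlt
      have hsum : ∑ a ∈ S, u l a = 1 := by
        rw [← hu1 l]
        refine Finset.sum_subset (Finset.subset_univ S) fun a _ haS => hus l a fun ⟨has, hal⟩ => ?_
        exact hl a (Finset.mem_sdiff.2 ⟨has, haS⟩) hal
      have hne : S.Nonempty := Finset.card_pos.1 (by omega)
      have h1 := Finset.sum_lt_sum_of_nonempty hne hlt
      rw [hsum, Finset.sum_const, hScard, nsmul_eq_mul, mul_one_div, lt_div_iff₀ (by positivity)]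
        at h1
      push_cast at h1
      have : (0 : ℝ) ≤ f := by positivity
      nlinarith
    refine ⟨a, haS, ?_⟩
    calc 1 / (((f : ℝ) + 1) * ((d + 1) * f + 1))
        = ((f : ℝ) + 1)⁻¹ * (1 / ((d + 1) * f + 1)) := by rw [one_div, mul_inv, one_div]
      _ ≤ (Q.card : ℝ)⁻¹ * u l a := by
          gcongr
          exact_mod_cast hQle
      _ ≤ (Q.card : ℝ)⁻¹ * ∑ l ∈ Q, u l a := by
          gcongr
          exact Finset.single_le_sum (fun l _ => hu0 l a) hlQ

/-- One update step of process `i` is a convex combination of the values of the processes outside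
`F`, in which `i` itself and all but `d f` of its in-neighbours outside `F` have a weight that is
not small. -/
theorem IsUpdate.exists_weights {n d f : ℕ} {N F : Finset (Fin n)} {g : Fin n → Point d}
    {i : Fin n} (hi : i ∉ F) (hF : F.card ≤ f) {y : Point d}
    (hy : IsUpdate f (N.val.map g) (g i) y) (hN : (d + 1) * f + 1 ≤ N.card ∨ N.card ≤ d * f) :
    ∃ w : Fin n → ℝ, (∀ j, 0 ≤ w j) ∧ (∀ j ∈ F, w j = 0) ∧ ∑ j, w j = 1 ∧
      ∑ j, w j • g j = y ∧
      1 / (1 + (N.card.choose ((d + 1) * f + 1) : ℝ)) ≤ w i ∧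
      (N.filter fun j => j ∉ F ∧ w j < 1 / (((f : ℝ) + 1) * ((d + 1) * f + 1)) *
        (1 / (1 + (N.card.choose ((d + 1) * f + 1) : ℝ)))).card ≤ d * f := by
  obtain ⟨Z, hZ, rfl⟩ := hy
  set k := (d + 1) * f + 1 with hk
  rw [Multiset.powersetCard_map, ← Finset.map_val_val_powersetCard, Multiset.map_map,
    Multiset.rel_map_left] at hZ
  obtain ⟨z, rfl, hz⟩ := exists_map_of_rel hZ
  have hex : ∀ s ∈ N.powersetCard k, _ := fun s hs =>
    IsTverbergPoint.exists_weights (F := F) (hz s hs) (Finset.mem_powersetCard.1 hs).2 hF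
  choose! u hu0 hus hu1 hup huS using hex
  set M : ℝ := (N.card.choose k : ℝ) with hM
  have hcard : (((N.powersetCard k).val.map z).card : ℝ) = M := by
    simp [hM]
  have hM1 : 0 < 1 + M := by positivity
  have hMcard : ((N.powersetCard k).card : ℝ) = M := by simp [hM]
  have hsplit : ∀ j, 0 ≤ ∑ s ∈ N.powersetCard k, u s j := fun j =>
    Finset.sum_nonneg fun s hs => hu0 s hs j
  refine ⟨fun j => (1 + M)⁻¹ * ((if j = i then 1 else 0) + ∑ s ∈ N.powersetCard k, u s j),
    fun j => ?_, fun j hj => ?_, ?_, ?_, ?_, ?_⟩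
  · exact mul_nonneg (by positivity) (add_nonneg (by positivity) (hsplit j))
  · beta_reduce
    rw [if_neg (fun h : j = i => hi (h ▸ hj)), Finset.sum_eq_zero, add_zero, mul_zero]
    exact fun s hs => hus s hs j (by simp [hj])
  · rw [← Finset.mul_sum, Finset.sum_add_distrib, Finset.sum_comm, Finset.sum_congr rfl hu1]
    simp only [Finset.sum_ite_eq', Finset.mem_univ, if_true, Finset.sum_const, nsmul_eq_mul,
      mul_one, hMcard]
    exact inv_mul_cancel₀ hM1.ne'
  · simp only [mul_smul, add_smul, Finset.sum_smul]
    rw [← Finset.smul_sum, Finset.sum_add_distrib, Finset.sum_comm, Finset.sum_congr rfl hup,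
      hcard]
    simp
  · beta_reduce
    rw [one_div, if_pos rfl]
    exact le_mul_of_one_le_right (by positivity) (by linarith [hsplit i])
  · by_contra! hlt
    obtain ⟨S, hS, hScard⟩ := Finset.exists_subset_card_eq hlt
    have hSN : S ⊆ N := hS.trans (Finset.filter_subset _ _)
    have hNk : k ≤ N.card := hN.resolve_right fun h => by
      have := Finset.card_le_card hSN
      omega
    -- A set `S` of `df+1` light in-neighbours extends to a selection of size `k`, whose Tverberg
    -- point makes a member of `S` heavy.
    obtain ⟨s, hSs, hsN, hs⟩ := Finset.exists_subsuperset_card_eq hSN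
      (by rw [hScard, hk, add_mul]; omega) hNk
    have hsP : s ∈ N.powersetCard k := Finset.mem_powersetCard.2 ⟨hsN, hs⟩
    obtain ⟨a, haS, ha⟩ := huS s hsP S hSs (Finset.disjoint_left.2 fun a haS =>
      (Finset.mem_filter.1 (hS haS)).2.1) hScard
    have hlt := (Finset.mem_filter.1 (hS haS)).2.2
    refine hlt.not_ge ?_
    rw [mul_comm, one_div (1 + M)]
    refine mul_le_mul_of_nonneg_left (ha.trans ?_) (by positivity)
    have h1 := Finset.single_le_sum (fun s hs => hu0 s hs a) hsP
    have h2 : (0 : ℝ) ≤ if a = i then 1 else 0 := by positivity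
    linarith

/-! ## Consequences of Condition SC -/

theorem mem_inNbrs {n : ℕ} {G : Digraph (Fin n)} {i j : Fin n} : j ∈ inNbrs G i ↔ G.Adj j i := by
  simp [inNbrs]

theorem card_inNbrs_lt {n : ℕ} {G : Digraph (Fin n)} (hG : ∀ i, ¬ G.Adj i i) (i : Fin n) :
    (inNbrs G i).card < n := by
  have : inNbrs G i ⊂ Finset.univ :=
    Finset.ssubset_univ_iff.2 fun h => hG i (mem_inNbrs.1 (h ▸ Finset.mem_univ i))
  simpa using Finset.card_lt_card this

/-- The in-degree of a process is not in the range `d f + 1, …, (d + 1) f`. -/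
theorem ConditionSC.card_inNbrs {n d f : ℕ} {G : Digraph (Fin n)} (hSC : ConditionSC d f G)
    (hd : 0 < d) (hG : ∀ i, ¬ G.Adj i i) (i : Fin n) :
    (d + 1) * f + 1 ≤ (inNbrs G i).card ∨ (inNbrs G i).card ≤ d * f := by
  by_contra! h
  obtain ⟨h1, h2⟩ := h
  rw [add_mul] at h1
  have hf : 0 < f := by omega
  have hfd : f ≤ d * f := Nat.le_mul_of_pos_left f hd
  obtain ⟨F, hFN, hF⟩ := Finset.exists_subset_card_eq (show f ≤ (inNbrs G i).card by omega)
  have hiN : i ∉ inNbrs G i := fun h => hG i (mem_inNbrs.1 h)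
  have hiF : i ∉ F := fun h => hiN (hFN h)
  obtain ⟨j, hjN, hjF⟩ := Finset.exists_mem_notMem_of_card_lt_card
    (show F.card < (inNbrs G i).card by omega)
  have hji : j ≠ i := fun h => hiN (h ▸ hjN)
  -- With `f` in-neighbours of `i` put in `F`, at most `df` remain to feed `{i}`, and `i` alone
  -- cannot supply `df + 1 ≥ 2` edges.
  have hcases := hSC F {i} ∅ (Finset.univ \ (F ∪ {i})) (by simpa using hiF) (by simp)
    (Finset.disjoint_left.2 fun a ha ha' => by simp [ha] at ha') (by simp)
    (by simp) (by simp) (by ext a; simp) (by simp) ⟨j, by simp [hjF, hji]⟩ hF.le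
  rcases hcases with ⟨v, hv, hc⟩ | ⟨v, -, hc⟩
  · obtain rfl := Finset.mem_singleton.1 hv
    have hsub : inNbrs G v ∩ (Finset.univ \ (F ∪ {v}) ∪ ∅) ⊆ inNbrs G v \ F := by
      intro a
      simp only [Finset.mem_inter, Finset.mem_sdiff, Finset.mem_union, Finset.union_empty]
      tauto
    have := Finset.card_le_card hsub
    rw [Finset.card_sdiff_of_subset hFN, hF] at this
    omega
  · have := Finset.card_le_card (Finset.inter_subset_right (s₁ := inNbrs G v) (s₂ := {i} ∪ ∅))
    simp only [Finset.union_empty, Finset.card_singleton] at this hc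
    omega

/-- In a reduced graph, one of two disjoint non-empty sets has an incoming edge. -/
theorem ConditionSC.exists_adj {n d f : ℕ} {G : Digraph (Fin n)} (hSC : ConditionSC d f G)
    {F : Finset (Fin n)} (hF : F.card ≤ f) {H : Digraph {v : Fin n // v ∉ F}}
    (hH : IsReducedGraph d f G F H) {L R : Set {v : Fin n // v ∉ F}} (hL : L.Nonempty)
    (hR : R.Nonempty) (hLR : Disjoint L R) :
    (∃ a b, a ∉ L ∧ b ∈ L ∧ H.Adj a b) ∨ ∃ a b, a ∉ R ∧ b ∈ R ∧ H.Adj a b := by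
  classical
  -- At most `df` in-edges are removed at a vertex, so one of `df+1` survives.
  have key : ∀ (L : Set {v : Fin n // v ∉ F}) (A B : Finset (Fin n)),
      (∀ a ∈ A, ∃ h : a ∉ F, ⟨a, h⟩ ∉ L) → (∀ b ∈ B, ∃ h : b ∉ F, ⟨b, h⟩ ∈ L) →
      FeedsInto G (d * f) A B → ∃ a b, a ∉ L ∧ b ∈ L ∧ H.Adj a b := by
    rintro L A B hA hB ⟨v, hv, hc⟩
    obtain ⟨hvF, hvL⟩ := hB v hv
    by_contra! hno
    have h1 := hH.2 ⟨v, hvF⟩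
    have h2 : (inNbrs G v ∩ A).card ≤
        {a : {v : Fin n // v ∉ F} | G.Adj a v ∧ ¬ H.Adj a ⟨v, hvF⟩}.ncard := by
      rw [← Set.ncard_image_of_injective _ Subtype.val_injective, ← Set.ncard_coe_finset]
      refine Set.ncard_le_ncard (fun a ha => ?_) (Set.toFinite _)
      obtain ⟨haN, haA⟩ := Finset.mem_inter.1 ha
      obtain ⟨haF, haL⟩ := hA a haA
      exact ⟨⟨a, haF⟩, ⟨mem_inNbrs.1 haN, hno _ _ haL hvL⟩, rfl⟩
    exact absurd (hc.trans h2) (by simpa using h1)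
  let lift : Set {v : Fin n // v ∉ F} → Finset (Fin n) := fun S =>
    Finset.univ.filter fun a => ∃ h : a ∉ F, ⟨a, h⟩ ∈ S
  have hlift : ∀ S a, a ∈ lift S ↔ ∃ h : a ∉ F, ⟨a, h⟩ ∈ S := fun S a => by simp [lift]
  have hne : ∀ S : Set {v : Fin n // v ∉ F}, S.Nonempty → (lift S).Nonempty := by
    rintro S ⟨a, ha⟩
    exact ⟨a, (hlift S a).2 ⟨a.2, ha⟩⟩
  have hdF : ∀ S, Disjoint F (lift S) := fun S =>
    Finset.disjoint_left.2 fun a ha ha' => ((hlift S a).1 ha').1 ha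
  have hdisj : ∀ S S', Disjoint S S' → Disjoint (lift S) (lift S') := fun S S' h =>
    Finset.disjoint_left.2 fun a ha ha' => by
      obtain ⟨h1, h2⟩ := (hlift S a).1 ha
      obtain ⟨h3, h4⟩ := (hlift S' a).1 ha'
      exact Set.disjoint_left.1 h h2 h4
  have hmem : ∀ S S', Disjoint S S' → ∀ a ∈ lift S', ∃ h : a ∉ F, ⟨a, h⟩ ∉ S := fun S S' h a ha => by
    obtain ⟨h1, h2⟩ := (hlift S' a).1 ha
    exact ⟨h1, fun h3 => Set.disjoint_left.1 h h3 h2⟩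
  have hdC : ∀ S, S ⊆ L ∪ R → Disjoint S (L ∪ R)ᶜ := fun S hS =>
    Set.disjoint_left.2 fun a ha ha' => ha' (hS ha)
  have hdL := hdC L Set.subset_union_left
  have hdR := hdC R Set.subset_union_right
  rcases hSC F (lift L) (lift (L ∪ R)ᶜ) (lift R) (hdF _) (hdF _) (hdF _) (hdisj _ _ hdL)
    (hdisj _ _ hLR) (hdisj _ _ hdR.symm) (by
      ext a
      simp only [Finset.mem_union, hlift, Finset.mem_univ, iff_true, Set.mem_compl_iff,
        Set.mem_union]
      by_cases haF : a ∈ F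
      · simp [haF]
      · simp only [haF, not_false_eq_true, exists_true_left, false_or]
        tauto) (hne _ hL) (hne _ hR) hF with h | h
  · refine .inl (key L _ _ (fun a ha => ?_) (fun b hb => (hlift L b).1 hb) h)
    rcases Finset.mem_union.1 ha with ha | ha
    · exact hmem _ _ hLR a ha
    · exact hmem _ _ hdL a ha
  · refine .inr (key R _ _ (fun a ha => ?_) (fun b hb => (hlift R b).1 hb) h)
    rcases Finset.mem_union.1 ha with ha | ha
    · exact hmem _ _ hLR.symm a ha
    · exact hmem _ _ hdR a ha

/-- Every reduced graph has a vertex from which all others can be reached. -/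
theorem ConditionSC.exists_root {n d f : ℕ} {G : Digraph (Fin n)} (hSC : ConditionSC d f G)
    {F : Finset (Fin n)} (hF : F.card ≤ f) [Nonempty {v : Fin n // v ∉ F}]
    {H : Digraph {v : Fin n // v ∉ F}} (hH : IsReducedGraph d f G F H) :
    ∃ s, ∀ v, Relation.ReflTransGen H.Adj s v := by
  let A : {v : Fin n // v ∉ F} → Set {v : Fin n // v ∉ F} := fun v =>
    {u | Relation.ReflTransGen H.Adj u v}
  have hclosed : ∀ v, ¬ ∃ a b, a ∉ A v ∧ b ∈ A v ∧ H.Adj a b := by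
    rintro v ⟨a, b, ha, hb, hab⟩
    exact ha (Relation.ReflTransGen.head hab hb)
  -- No edge enters an ancestor set, so any two of them meet. A common ancestor `u` of `s` and `v`
  -- has `A u = A s` by minimality, hence `s` reaches `u` and then `v`.
  obtain ⟨s, hs⟩ := Finite.exists_min fun v => (A v).ncard
  refine ⟨s, fun v => ?_⟩
  have hnd : ¬ Disjoint (A s) (A v) := fun h =>
    (hSC.exists_adj hF hH ⟨s, .refl⟩ ⟨v, .refl⟩ h).elim (hclosed s) (hclosed v)
  obtain ⟨u, hus, huv⟩ := Set.not_disjoint_iff.1 hnd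
  have hsub : A u ⊆ A s := fun a ha => Relation.ReflTransGen.trans ha hus
  have heq : A u = A s := Set.eq_of_subset_of_ncard_le hsub (hs u) (Set.toFinite _)
  have : s ∈ A u := heq ▸ Relation.ReflTransGen.refl
  exact Relation.ReflTransGen.trans this huv

/-! ## Contraction of the spread under rooted averaging -/

/-- The vertices reached from `s` in `k` steps, where vertices may be waited at, and step `t` uses
the edges of `H t`. -/
def reached {ι : Type*} (H : ℕ → Digraph ι) (s : ι) : ℕ → Set ι
  | 0 => {s}
  | k + 1 => {i | ∃ j ∈ reached H s k, j = i ∨ (H k).Adj j i}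

theorem reached_subset_succ {ι : Type*} (H : ℕ → Digraph ι) (s : ι) (k : ℕ) :
    reached H s k ⊆ reached H s (k + 1) := fun i hi => ⟨i, hi, .inl rfl⟩

theorem self_mem_reached {ι : Type*} (H : ℕ → Digraph ι) (s : ι) (k : ℕ) : s ∈ reached H s k := by
  induction k with
  | zero => rfl
  | succ k ih => exact reached_subset_succ H s k ih

theorem exists_adj_of_reflTransGen {ι : Type*} {r : ι → ι → Prop} {s v : ι} {S : Set ι}
    (h : Relation.ReflTransGen r s v) (hs : s ∈ S) (hv : v ∉ S) : ∃ a ∈ S, ∃ b ∉ S, r a b := by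
  induction h with
  | refl => exact absurd hs hv
  | @tail b c _ hbc ih =>
    by_cases hb : b ∈ S
    · exact ⟨b, hb, c, hv, hbc⟩
    · exact ih hb

/-- Everything is reached from a root of a graph that is used sufficiently often. -/
theorem min_le_ncard_reached {ι : Type*} [Finite ι] [DecidableEq (Digraph ι)] (H : ℕ → Digraph ι)
    {H₀ : Digraph ι} {s : ι} (hs : ∀ v, Relation.ReflTransGen H₀.Adj s v) (k : ℕ) :
    min (Nat.card ι) (((Finset.range k).filter fun t => H t = H₀).card + 1) ≤
      (reached H s k).ncard := by
  induction k with
  | zero => simp [reached]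
  | succ k ih =>
    have hmono := Set.ncard_le_ncard (reached_subset_succ H s k) (Set.toFinite _)
    rw [Finset.range_add_one, Finset.filter_insert]
    split_ifs with hk
    · by_cases huniv : reached H s k = Set.univ
      · have : reached H s (k + 1) = Set.univ :=
          Set.univ_subset_iff.1 (huniv ▸ reached_subset_succ H s k)
        rw [this, Set.ncard_univ]
        exact min_le_left _ _
      · obtain ⟨v, hv⟩ := (Set.ne_univ_iff_exists_notMem _).1 huniv
        obtain ⟨a, ha, b, hb, hab⟩ := exists_adj_of_reflTransGen (hs v) (self_mem_reached H s k) hv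
        have hlt : (reached H s k).ncard < (reached H s (k + 1)).ncard := by
          refine Set.ncard_lt_ncard ⟨reached_subset_succ H s k, fun h => hb (h ?_)⟩ (Set.toFinite _)
          exact ⟨a, ha, .inr (hk ▸ hab)⟩
        rw [Finset.card_insert_of_notMem (by simp)]
        omega
    · exact ih.trans hmono

/-- If the graphs `H t` belong to a finite set of rooted graphs, then after sufficiently many steps
everything is reached from one vertex. -/
theorem exists_reached_eq_univ {ι : Type*} [Finite ι] (H : ℕ → Digraph ι)
    (𝓗 : Finset (Digraph ι)) (hroot : ∀ H₀ ∈ 𝓗, ∃ s, ∀ v, Relation.ReflTransGen H₀.Adj s v)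
    {K : ℕ} (hmem : ∀ t < K, H t ∈ 𝓗) (hK : 𝓗.card * (Nat.card ι - 1) < K) :
    ∃ s, reached H s K = Set.univ := by
  classical
  obtain ⟨H₀, hH₀, hcard⟩ := Finset.exists_lt_card_fiber_of_mul_lt_card_of_maps_to
    (s := Finset.range K) (t := 𝓗) (f := H) (fun t ht => hmem t (Finset.mem_range.1 ht))
    (by rwa [Finset.card_range])
  obtain ⟨s, hs⟩ := hroot H₀ hH₀
  refine ⟨s, Set.eq_of_subset_of_ncard_le (Set.subset_univ _) ?_⟩
  rw [Set.ncard_univ]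
  have h1 := min_le_ncard_reached H hs K
  have h2 := Set.ncard_le_card (reached H s K)
  omega

/-- `y` arises from `x` by averaging with weights that are at least `β` along the edges of `H` and
at each vertex itself. -/
def IsAveraging {ι : Type*} [Fintype ι] (β : ℝ) (H : Digraph ι) (x y : ι → ℝ) : Prop :=
  ∀ i, ∃ w : ι → ℝ, (∀ j, 0 ≤ w j) ∧ ∑ j, w j = 1 ∧ y i = ∑ j, w j * x j ∧ β ≤ w i ∧
    ∀ j, H.Adj j i → β ≤ w j

theorem IsAveraging.neg {ι : Type*} [Fintype ι] {β : ℝ} {H : Digraph ι} {x y : ι → ℝ}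
    (h : IsAveraging β H x y) : IsAveraging β H (-x) (-y) := fun i => by
  obtain ⟨w, hw0, hw1, hy, hi, hadj⟩ := h i
  exact ⟨w, hw0, hw1, by simp [hy], hi, hadj⟩

theorem IsAveraging.le {ι : Type*} [Fintype ι] {β : ℝ} {H : Digraph ι} {x y : ι → ℝ}
    (h : IsAveraging β H x y) {m : ℝ} (hm : ∀ i, m ≤ x i) (i : ι) : m ≤ y i := by
  obtain ⟨w, hw0, hw1, hy, -, -⟩ := h i
  rw [hy, ← one_mul m, ← hw1, Finset.sum_mul]
  exact Finset.sum_le_sum fun j _ => mul_le_mul_of_nonneg_left (hm j) (hw0 j)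

theorem IsAveraging.ge {ι : Type*} [Fintype ι] {β : ℝ} {H : Digraph ι} {x y : ι → ℝ}
    (h : IsAveraging β H x y) {M : ℝ} (hM : ∀ i, x i ≤ M) (i : ι) : y i ≤ M :=
  neg_le_neg_iff.1 (h.neg.le (m := -M) (fun j => neg_le_neg (hM j)) i)

/-- Each step along an edge or a wait keeps at least the fraction `β` of the excess over `m`; all
other contributions to the average are non-negative. -/
theorem le_of_mem_reached {ι : Type*} [Fintype ι] {β : ℝ} (hβ : 0 ≤ β) {H : ℕ → Digraph ι}
    {x : ℕ → ι → ℝ} {K : ℕ} (hx : ∀ k < K, IsAveraging β (H k) (x k) (x (k + 1))) {m : ℝ}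
    (hm : ∀ i, m ≤ x 0 i) (s : ι) {k : ℕ} (hk : k ≤ K) :
    (∀ i, m ≤ x k i) ∧ ∀ i ∈ reached H s k, m + β ^ k * (x 0 s - m) ≤ x k i := by
  induction k with
  | zero =>
    refine ⟨hm, fun i hi => ?_⟩
    obtain rfl : i = s := hi
    simp
  | succ k ih =>
    obtain ⟨ihm, ihs⟩ := ih (by omega)
    refine ⟨(hx k hk).le ihm, fun i hi => ?_⟩
    obtain ⟨j, hj, hji⟩ := hi
    obtain ⟨w, hw0, hw1, hy, hi, hadj⟩ := hx k hk i
    have hβj : β ≤ w j := hji.elim (fun h => h ▸ hi) (hadj j)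
    have h1 : x (k + 1) i - m = ∑ l, w l * (x k l - m) := by
      simp only [mul_sub, Finset.sum_sub_distrib, ← Finset.sum_mul, hw1, hy, one_mul]
    have h2 : w j * (x k j - m) ≤ ∑ l, w l * (x k l - m) :=
      Finset.single_le_sum (f := fun l => w l * (x k l - m))
        (fun l _ => mul_nonneg (hw0 l) (sub_nonneg.2 (ihm l))) (Finset.mem_univ j)
    have h3 : β * (β ^ k * (x 0 s - m)) ≤ w j * (x k j - m) :=
      mul_le_mul hβj (by linarith [ihs j hj])
        (mul_nonneg (pow_nonneg hβ k) (sub_nonneg.2 (hm s))) (hw0 j)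
    rw [pow_succ']
    linarith

/-- The spread shrinks by the factor `1 - β ^ K` over `K` steps after which some vertex has reached
all others. -/
theorem spread_contracts {ι : Type*} [Fintype ι] {β : ℝ} (hβ : 0 ≤ β) {H : ℕ → Digraph ι}
    {x : ℕ → ι → ℝ} {K : ℕ} (hx : ∀ k < K, IsAveraging β (H k) (x k) (x (k + 1))) {s : ι}
    (hs : reached H s K = Set.univ) {m M : ℝ} (hm : ∀ i, m ≤ x 0 i) (hM : ∀ i, x 0 i ≤ M) :
    ∃ m' M', (∀ i, m' ≤ x K i ∧ x K i ≤ M') ∧ M' - m' = (1 - β ^ K) * (M - m) := by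
  have h1 := (le_of_mem_reached hβ hx hm s le_rfl).2
  -- The upper bound comes from `-x` with the same `s`, so the two gains add up to `β ^ K * (M -
  -- m)`.
  have h2 := (le_of_mem_reached hβ (x := fun k => -x k) (fun k hk => (hx k hk).neg) (m := -M)
    (fun i => neg_le_neg (hM i)) s le_rfl).2
  rw [hs] at h1 h2
  refine ⟨m + β ^ K * (x 0 s - m), M - β ^ K * (M - x 0 s), fun i => ⟨h1 i trivial, ?_⟩, by ring⟩
  have := h2 i trivial
  simp only [Pi.neg_apply] at this
  linarith

/-- The spread after `T` steps of averaging along rooted graphs from a finite set. -/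
theorem abs_sub_le_of_isAveraging {ι : Type*} [Fintype ι] {β : ℝ} (hβ : 0 ≤ β)
    {H : ℕ → Digraph ι} {x : ℕ → ι → ℝ} (𝓗 : Finset (Digraph ι))
    (hroot : ∀ H₀ ∈ 𝓗, ∃ s, ∀ v, Relation.ReflTransGen H₀.Adj s v) {K T : ℕ}
    (hK : 𝓗.card * (Nat.card ι - 1) < K) (hmem : ∀ t < T, H t ∈ 𝓗)
    (hx : ∀ t < T, IsAveraging β (H t) (x t) (x (t + 1))) {m M : ℝ}
    (hm : ∀ i, m ≤ x 0 i) (hM : ∀ i, x 0 i ≤ M) (i j : ι) :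
    |x T i - x T j| ≤ (1 - β ^ K) ^ (T / K) * (M - m) := by
  have hphase : ∀ q, q * K ≤ T → ∃ m' M', (∀ i, m' ≤ x (q * K) i ∧ x (q * K) i ≤ M') ∧
      M' - m' = (1 - β ^ K) ^ q * (M - m) := by
    intro q
    induction q with
    | zero => exact fun _ => ⟨m, M, fun i => by simpa using ⟨hm i, hM i⟩, by simp⟩
    | succ q ih =>
      intro hq
      rw [Nat.succ_mul] at hq
      obtain ⟨m', M', hb, hspread⟩ := ih (by omega)
      obtain ⟨s, hs⟩ := exists_reached_eq_univ (fun k => H (q * K + k)) 𝓗 hroot (K := K)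
        (fun t ht => hmem _ (by omega)) hK
      obtain ⟨m'', M'', hb', hspread'⟩ := spread_contracts hβ (x := fun k => x (q * K + k))
        (fun k hk => hx (q * K + k) (by omega)) hs (fun i => (hb i).1) fun i => (hb i).2
      refine ⟨m'', M'', ?_, ?_⟩
      · rw [Nat.succ_mul]
        exact hb'
      · rw [hspread', hspread, pow_succ']
        ring
  obtain ⟨m', M', hb, hspread⟩ := hphase (T / K) (Nat.div_mul_le_self T K)
  -- The incomplete last phase cannot widen the bounds.
  have hkeep : ∀ t, T / K * K ≤ t → t ≤ T → ∀ i, m' ≤ x t i ∧ x t i ≤ M' := by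
    intro t ht
    induction t, ht using Nat.le_induction with
    | base => exact fun _ => hb
    | succ t ht ih =>
      intro htT i
      have ih := ih (by omega)
      exact ⟨(hx t htT).le (fun i => (ih i).1) i, (hx t htT).ge (fun i => (ih i).2) i⟩
  have hi := hkeep T (Nat.div_mul_le_self T K) le_rfl i
  have hj := hkeep T (Nat.div_mul_le_self T K) le_rfl j
  rw [← hspread, abs_le]
  constructor <;> linarith

/-! ## The constants -/

theorem beta_pos {n : ℕ} (hn : 2 ≤ n) (d f : ℕ) : 0 < beta n d f := by
  have : (0 : ℝ) < n := by positivity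
  unfold beta
  split_ifs <;> positivity

theorem beta_le_of_card_lt {n : ℕ} (d f : ℕ) {N : ℕ} (hN : N < n) :
    beta n d f ≤ 1 / (1 + (N.choose ((d + 1) * f + 1) : ℝ)) := by
  have hn : (1 : ℝ) ≤ n := by exact_mod_cast (by omega : 1 ≤ n)
  unfold beta
  split_ifs with hf
  · subst hf
    simp only [mul_zero, zero_add, Nat.choose_one_right]
    gcongr
    exact_mod_cast (by omega : 1 + N ≤ n)
  · have h1 : (N.choose ((d + 1) * f + 1) : ℝ) ≤ n.choose ((d + 1) * f + 1) := by
      exact_mod_cast Nat.choose_le_choose _ hN.le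
    have h2 : (1 : ℝ) ≤ (n : ℝ) ^ 2 := one_le_pow₀ hn
    gcongr
    have : (0 : ℝ) ≤ n.choose ((d + 1) * f + 1) := by positivity
    nlinarith

/-- For `f > 0` the factor `n²` in `β` pays for `f + 1` and `(d+1)f + 1`, both at most `n`. -/
theorem beta_le_mul_of_card_lt {n d f : ℕ} (hd : 0 < d) {N : ℕ} (hN : N < n)
    (hNk : (d + 1) * f + 1 ≤ N) :
    beta n d f ≤ 1 / (((f : ℝ) + 1) * ((d + 1) * f + 1)) *
      (1 / (1 + (N.choose ((d + 1) * f + 1) : ℝ))) := by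
  by_cases hf : f = 0
  · refine (beta_le_of_card_lt d f hN).trans ?_
    simp [hf]
  · have h1 : ((d : ℝ) + 1) * f + 1 ≤ n := by exact_mod_cast hNk.trans hN.le
    have h2 : (f : ℝ) + 1 ≤ n := by
      have : f + 1 ≤ n := by
        have := Nat.le_mul_of_pos_left f (Nat.succ_pos d)
        rw [Nat.succ_eq_add_one] at this
        omega
      exact_mod_cast this
    have h3 : (N.choose ((d + 1) * f + 1) : ℝ) ≤ n.choose ((d + 1) * f + 1) := by
      exact_mod_cast Nat.choose_le_choose _ hN.le
    rw [beta, if_neg hf, one_div_mul_one_div, sq]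
    gcongr

theorem ncard_isReducedGraph_le {n d f : ℕ} (G : Digraph (Fin n)) {F : Finset (Fin n)}
    (hF : F.card ≤ f) :
    {H : Digraph {v : Fin n // v ∉ F} | IsReducedGraph d f G F H}.ncard ≤ maxReduced d f G :=
  Finset.le_sup (f := fun F : Finset (Fin n) =>
    {H : Digraph {v : Fin n // v ∉ F} | IsReducedGraph d f G F H}.ncard) (by simpa using hF)

instance finite_digraph {V : Type*} [Finite V] : Finite (Digraph V) := by
  classical
  have := Fintype.ofFinite V
  infer_instance

theorem maxReduced_pos {n : ℕ} (d f : ℕ) (G : Digraph (Fin n)) : 0 < maxReduced d f G := by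
  refine lt_of_lt_of_le ?_ (ncard_isReducedGraph_le (F := ∅) G (Nat.zero_le f))
  refine (Set.ncard_pos (Set.toFinite _)).2 ⟨⟨fun a b => G.Adj a b⟩, fun a b h => h, fun b => ?_⟩
  simp

theorem one_sub_beta_pow_mem {n : ℕ} (hn : 2 ≤ n) (d f k : ℕ) :
    0 ≤ 1 - beta n d f ^ k ∧ 1 - beta n d f ^ k < 1 := by
  have h0 := beta_pos hn d f
  have h1 : beta n d f ≤ 1 := by
    refine (beta_le_of_card_lt d f (show 0 < n by omega)).trans ?_
    simp
  exact ⟨sub_nonneg.2 (pow_le_one₀ h0.le h1), sub_lt_self 1 (pow_pos h0 k)⟩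

/-- `tEnd` exists. -/
theorem isLeast_tEnd {n : ℕ} (hn : 2 ≤ n) (d f : ℕ) (G : Digraph (Fin n)) (μ U : ℝ) {ε : ℝ}
    (hε : 0 < ε) : IsLeast (stoppingTimes d f G μ U ε) (tEnd d f G μ U ε) := by
  refine ⟨Nat.sInf_mem ?_, fun t ht => Nat.sInf_le ht⟩
  set K := maxReduced d f G * n with hK
  have hKpos : 0 < K := Nat.mul_pos (maxReduced_pos d f G) (by omega)
  obtain ⟨h0, h1⟩ := one_sub_beta_pow_mem hn d f K
  set C := (n : ℝ) * max |U| |μ| with hC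
  have hC0 : 0 ≤ C := by positivity
  -- `C + 1` avoids dividing by zero when `C = 0`; `q + 1` below makes the time positive.
  obtain ⟨q, hq⟩ := exists_pow_lt_of_lt_one (show 0 < ε / (C + 1) by positivity) h1
  refine ⟨K * (q + 1), by positivity, ?_⟩
  rw [contraction, ← hK, Nat.mul_div_cancel_left _ hKpos]
  have h2 : (1 - beta n d f ^ K) ^ (q + 1) * (C + 1) ≤ (1 - beta n d f ^ K) ^ q * (C + 1) :=
    mul_le_mul_of_nonneg_right (pow_le_pow_of_le_one h0 h1.le (Nat.le_succ q)) (by positivity)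
  have h3 : 0 ≤ (1 - beta n d f ^ K) ^ (q + 1) := pow_nonneg h0 _
  rw [lt_div_iff₀ (by positivity)] at hq
  rw [← hC]
  linarith

/-! ## Rounds and executions -/

theorem exists_isRound {n d f : ℕ} (G : Digraph (Fin n)) (T : ℕ) (F : Finset (Fin n))
    (s : Fin n → ProcState d) (adv : Fin n → Fin n → Option (Point d)) :
    ∃ s', IsRound f G T F s adv s' := by
  classical
  choose y hy using fun i => exists_isUpdate f (received G T F s adv i) (s i).value
  refine ⟨fun i => if Halted T (s i) then s i else ⟨(s i).iter + 1, y i⟩, fun i _ => ?_⟩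
  refine ⟨fun h => if_pos h, fun h => ?_⟩
  beta_reduce
  rw [if_neg h]
  exact ⟨rfl, hy i⟩

theorem sum_subtype_notMem {α M : Type*} [Fintype α] [DecidableEq α] [AddCommMonoid M]
    (F : Finset α) {φ : α → M} (h : ∀ j ∈ F, φ j = 0) :
    ∑ j : {v : α // v ∉ F}, φ j = ∑ j, φ j := by
  rw [← Finset.sum_subset (Finset.subset_univ Fᶜ) fun j _ hj => h j (by simpa using hj)]
  exact (Finset.sum_subtype Fᶜ (fun j => by simp) φ).symm

/-- In a round before termination, the new states of the fault-free processes are averages of the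
old ones, with weights bounded below along some reduced graph. -/
theorem IsRound.exists_weights {n d f T : ℕ} (hd : 0 < d) {G : Digraph (Fin n)}
    (hG : ∀ i, ¬ G.Adj i i) (hSC : ConditionSC d f G) {F : Finset (Fin n)} (hF : F.card ≤ f)
    {s s' : Fin n → ProcState d} {adv : Fin n → Fin n → Option (Point d)}
    (h : IsRound f G T F s adv s') (hs : ∀ i, i ∉ F → ¬ Halted T (s i)) :
    ∃ H : Digraph {v : Fin n // v ∉ F}, IsReducedGraph d f G F H ∧
      ∀ i : {v : Fin n // v ∉ F}, ∃ w : {v : Fin n // v ∉ F} → ℝ, (∀ j, 0 ≤ w j) ∧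
        ∑ j, w j = 1 ∧ (s' i).value = ∑ j, w j • (s j).value ∧ beta n d f ≤ w i ∧
        ∀ j, H.Adj j i → beta n d f ≤ w j := by
  classical
  have key : ∀ i : {v : Fin n // v ∉ F}, ∃ w : Fin n → ℝ, (∀ j, 0 ≤ w j) ∧ (∀ j ∈ F, w j = 0) ∧
      ∑ j, w j = 1 ∧ (s' i).value = ∑ j : {v : Fin n // v ∉ F}, w j • (s j).value ∧
      beta n d f ≤ w i ∧
      ((inNbrs G i).filter fun j => j ∉ F ∧ w j < beta n d f).card ≤ d * f := by
    rintro ⟨i, hi⟩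
    set g : Fin n → Point d := fun j => (message T F s adv j i).getD 0 with hg
    have hgs : ∀ j, j ∉ F → g j = (s j).value := fun j hj => by
      simp [hg, message, hj, hs j hj]
    -- Without a self-loop `i` receives nothing from itself, but `g i` is still its old state.
    have hupd : IsUpdate f ((inNbrs G i).val.map g) (g i) (s' i).value := by
      rw [hgs i hi]
      exact ((h i hi).2 (hs i hi)).2
    have hN := hSC.card_inNbrs hd hG i
    have hlt := card_inNbrs_lt hG i
    obtain ⟨w, hw0, hwF, hw1, hwy, hwi, hlight⟩ := hupd.exists_weights hi hF hN
    refine ⟨w, hw0, hwF, hw1, ?_, (beta_le_of_card_lt d f hlt).trans hwi, ?_⟩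
    · rw [← hwy, ← sum_subtype_notMem F fun j hj => by rw [hwF j hj, zero_smul]]
      exact Finset.sum_congr rfl fun j _ => by rw [hgs j j.2]
    · rcases hN with hN | hN
      · refine (Finset.card_le_card ?_).trans hlight
        exact Finset.monotone_filter_right _ fun j _ hj =>
          ⟨hj.1, hj.2.trans_le (beta_le_mul_of_card_lt hd hlt hN)⟩
      -- With in-degree at most `df`, all incoming edges may be removed.
      · exact (Finset.card_filter_le _ _).trans hN
  choose w hw0 hwF hw1 hwy hwi hlight using key
  -- The reduced graph keeps exactly the edges of weight at least `β`.
  refine ⟨⟨fun a b => G.Adj a b ∧ beta n d f ≤ w b a⟩, ⟨fun a b h => h.1, fun b => ?_⟩,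
    fun i => ⟨fun j => w i j, fun j => hw0 i j, ?_, hwy i, hwi i, fun j h => h.2⟩⟩
  · refine le_trans ?_ (hlight b)
    rw [← Set.ncard_image_of_injective _ Subtype.val_injective, ← Set.ncard_coe_finset]
    refine Set.ncard_le_ncard ?_ (Set.toFinite _)
    rintro _ ⟨a, ⟨haG, haH⟩, rfl⟩
    simp only [Finset.coe_filter, Set.mem_ofPred_eq, mem_inNbrs]
    exact ⟨haG, a.2, not_le.1 fun hle => haH ⟨haG, hle⟩⟩
  · rw [← hw1 i]
    exact sum_subtype_notMem F (hwF i)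

theorem IsExecution.iter_eq {n d f T : ℕ} {G : Digraph (Fin n)} {F : Finset (Fin n)}
    {input : Fin n → Point d} {adv : ℕ → Fin n → Fin n → Option (Point d)}
    {c : ℕ → Fin n → ProcState d} (h : IsExecution f G T F input adv c) (k : ℕ) {i : Fin n}
    (hi : i ∉ F) : (c k i).iter = min k T := by
  induction k with
  | zero => simp [h.1 i hi]
  | succ k ih =>
    obtain ⟨h1, h2⟩ := h.2 k i hi
    by_cases hT : Halted T (c k i)
    · rw [h1 hT, ih]
      rw [Halted, ih] at hT
      omega
    · rw [(h2 hT).1, ih]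
      rw [Halted, ih] at hT
      omega

theorem IsExecution.halted_iff {n d f T : ℕ} {G : Digraph (Fin n)} {F : Finset (Fin n)}
    {input : Fin n → Point d} {adv : ℕ → Fin n → Fin n → Option (Point d)}
    {c : ℕ → Fin n → ProcState d} (h : IsExecution f G T F input adv c) (k : ℕ) {i : Fin n}
    (hi : i ∉ F) : Halted T (c k i) ↔ T ≤ k := by
  rw [Halted, h.iter_eq k hi]
  omega

theorem IsExecution.eq_of_le {n d f T : ℕ} {G : Digraph (Fin n)} {F : Finset (Fin n)}
    {input : Fin n → Point d} {adv : ℕ → Fin n → Fin n → Option (Point d)}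
    {c : ℕ → Fin n → ProcState d} (h : IsExecution f G T F input adv c) {k : ℕ} (hk : T ≤ k)
    {i : Fin n} (hi : i ∉ F) : c k i = c T i := by
  induction k, hk using Nat.le_induction with
  | base => rfl
  | succ k hk ih => rw [((h.2 k i hi).1 ((h.halted_iff k hi).2 hk)), ih]

theorem IsExecution.eq_of_decides {n d f T : ℕ} {G : Digraph (Fin n)} {F : Finset (Fin n)}
    {input : Fin n → Point d} {adv : ℕ → Fin n → Fin n → Option (Point d)}
    {c : ℕ → Fin n → ProcState d} (h : IsExecution f G T F input adv c) {i : Fin n} (hi : i ∉ F)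
    {y : Point d} (hy : Decides T c i y) : y = (c T i).value := by
  obtain ⟨k, hk, rfl⟩ := hy
  rw [h.eq_of_le ((h.halted_iff k hi).1 hk) hi]

theorem mainTheorem1 (n d f : ℕ) (hn : 2 ≤ n) (hd : 0 < d)
    (G : Digraph (Fin n)) (hG : ∀ i, ¬ G.Adj i i) (hSC : ConditionSC d f G)
    (μ U ε : ℝ) (hε : 0 < ε) :
    IsLeast (stoppingTimes d f G μ U ε) (tEnd d f G μ U ε) ∧
    ∀ F : Finset (Fin n), F.card ≤ f →
      (∀ (s : Fin n → ProcState d) (adv : Fin n → Fin n → Option (Point d)),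
        ∃ s', IsRound f G (tEnd d f G μ U ε) F s adv s') ∧
      ∀ (input : Fin n → Point d), (∀ i, i ∉ F → ∀ l, μ ≤ input i l ∧ input i l ≤ U) →
        ∀ (adv : ℕ → Fin n → Fin n → Option (Point d)) (c : ℕ → Fin n → ProcState d),
          IsExecution f G (tEnd d f G μ U ε) F input adv c →
            Termination (tEnd d f G μ U ε) F c ∧ Validity F input c ∧
              EpsAgreement (tEnd d f G μ U ε) ε F c := by
  have hleast := isLeast_tEnd hn d f G μ U hε
  refine ⟨hleast, fun F hF => ⟨exists_isRound G _ F, fun input hinput adv c hc => ?_⟩⟩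
  obtain ⟨-, hsmall⟩ := hleast.1
  set T := tEnd d f G μ U ε
  have hstep : ∀ k < T, _ := fun k hk => IsRound.exists_weights hd hG hSC hF (hc.2 k) fun i hi h =>
    ((hc.halted_iff k hi).1 h).not_gt hk
  refine ⟨fun i hi => ⟨_, T, (hc.halted_iff T hi).2 le_rfl, rfl⟩, fun k => ?_, ?_⟩
  · induction k with
    | zero =>
      intro i hi
      rw [hc.1 i hi]
      exact subset_convexHull ℝ _ ⟨i, hi, rfl⟩
    | succ k ih =>
      intro i hi
      by_cases hk : T ≤ k
      · rw [hc.eq_of_le (by omega) hi, ← hc.eq_of_le hk hi]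
        exact ih i hi
      · obtain ⟨H, -, hH⟩ := hstep k (not_le.1 hk)
        obtain ⟨w, hw0, hw1, hw, -, -⟩ := hH ⟨i, hi⟩
        rw [hw]
        exact (convex_convexHull ℝ _).sum_mem (fun j _ => hw0 j) hw1 fun j _ => ih j j.2
  · intro i j hi hj y y' hy hy' l
    obtain rfl := hc.eq_of_decides hi hy
    obtain rfl := hc.eq_of_decides hj hy'
    have : Nonempty {v : Fin n // v ∉ F} := ⟨⟨i, hi⟩⟩
    choose! H hH hw using hstep
    have hfin : {H : Digraph {v : Fin n // v ∉ F} | IsReducedGraph d f G F H}.Finite :=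
      Set.toFinite _
    have hmem : ∀ H, H ∈ hfin.toFinset ↔ IsReducedGraph d f G F H := by simp
    have hcard : hfin.toFinset.card * (Nat.card {v : Fin n // v ∉ F} - 1) <
        maxReduced d f G * n := by
      have h1 : hfin.toFinset.card ≤ maxReduced d f G := by
        rw [← Set.ncard_eq_toFinset_card]
        exact ncard_isReducedGraph_le G hF
      have h2 : Nat.card {v : Fin n // v ∉ F} ≤ n := by
        simp
      refine lt_of_le_of_lt (Nat.mul_le_mul h1 (Nat.sub_le_sub_right h2 1)) ?_
      exact Nat.mul_lt_mul_of_pos_left (by omega) (maxReduced_pos d f G)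
    have hspread := abs_sub_le_of_isAveraging (beta_pos hn d f).le
      (x := fun k (v : {v : Fin n // v ∉ F}) => (c k v).value l) hfin.toFinset
      (fun H₀ hH₀ => hSC.exists_root hF ((hmem H₀).1 hH₀)) hcard (T := T)
      (fun t ht => (hmem _).2 (hH t ht)) (fun t ht v => by
        obtain ⟨w, hw0, hw1, hwy, hwi, hadj⟩ := hw t ht v
        exact ⟨w, hw0, hw1, by simp [hwy], hwi, hadj⟩) (m := μ) (M := U)
      (fun v => by rw [hc.1 v v.2]; exact (hinput v v.2 l).1)
      (fun v => by rw [hc.1 v v.2]; exact (hinput v v.2 l).2) ⟨i, hi⟩ ⟨j, hj⟩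
    refine (hspread.trans ?_).trans_lt hsmall
    refine mul_le_mul_of_nonneg_left ?_ (pow_nonneg (one_sub_beta_pow_mem hn d f _).1 _)
    -- The initial spread satisfies `U - μ ≤ 2 max(|U|, |μ|) ≤ n max(|U|, |μ|)`.
    have hn' : (2 : ℝ) ≤ n := by exact_mod_cast hn
    have h1 : U ≤ max |U| |μ| := (le_abs_self U).trans (le_max_left _ _)
    have h2 : -μ ≤ max |U| |μ| := (neg_le_abs μ).trans (le_max_right _ _)
    have h3 : 0 ≤ max |U| |μ| := (abs_nonneg U).trans (le_max_left _ _)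
    nlinarith
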